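/- **Setting.** Let $A$ be a finite non-empty set of agents and $P$ a denumerable set of atomic propositions. Formulae are generated by $\varphi ::= \bot \mid p \mid \varphi\wedge\varphi \mid \varphi\vee\varphi \mid \varphi\to\varphi \mid K_a\varphi \mid C\varphi$ ($p\in P$, $a\in A$). A birelational frame consists of a non-empty poset $(W,\le)$ and relations $R_a\subseteq W\times W$ ($a\in A$); it is *epistemic* if $w\le v$ and $v R_a u$ imply $w R_a u$. An epistemic frame is *reflexive* if every $R_a$ is reflexive, and an *S4 frame* if every $R_a$ is reflexive and transitive. A model adds a valuation $V:W\to\mathcal P(P)$ with $V(w)\subseteq V(v)$ whenever $w\le v$. Truth is as usual in intuitionistic Kripke semantics for atoms, $\bot,\wedge,\vee,\to$ (implication quantifies over all $v\ge w$); $w\models K_a\varphi$ iff $v\models\varphi$ for all $v$ with $wR_av$; $w\models C\varphi$ iff $v\models\varphi$ for all $v$ with $wR^*v$, where $R^*$ is the reflexive-transitive closure of $\bigcup_a R_a$. A formula is valid over a class of frames if it is true at all worlds of all models based on frames in the class. An annotated formula is $\varphi^u$ (unfocused) or $\varphi^f$ (in focus). A *sequent* $\Gamma\Rightarrow\Delta$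 is a pair of finite sets of annotated formulae such that all formulae in $\Gamma$ are unfocused, at most one formula in $\Delta$ is in focus, and a formula in focus has the form $C\psi$ or $K_aC\psi$. It is valid over a class of frames if $\bigwedge\Gamma^-\to\bigvee\Delta^-$ is, where $^-$ erases annotations (the empty conjunction is $\bot\to\bot$, the empty disjunction is $\bot$). **Rules** (conclusion $\Leftarrow$ premises; comma is union of sets; $e\in\{u,f\}$; $K_a\Gamma=\{K_a\varphi^{e}:\varphi^{e}\in\Gamma\}$; the conclusion and all premises must be sequents). - $\mathsf{id}$: $\Gamma,\varphi^u\Rightarrow\varphi^e,\Delta$ and $\bot$: $\Gamma,\bot^u\Rightarrow\Delta$, both without premises (the *axioms*); - $\wedge L$: $\Gamma,\varphi\wedge\psi^u\Rightarrow\Delta \Leftarrow \Gamma,\varphi^u,\psi^u\Rightarrow\Delta$; $\wedge R$: $\Gamma\Rightarrow\varphi\wedge\psi^u,\Delta \Leftarrow \Gamma\Rightarrow\varphi^u,\Delta$ and $\Gamma\Rightarrow\psi^u,\Delta$; - $\vee L$: $\Gamma,\varphi\vee\psi^u\Rightarrow\Delta \Leftarrow \Gamma,\varphi^u\Rightarrow\Delta$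 and $\Gamma,\psi^u\Rightarrow\Delta$; $\vee R$: $\Gamma\Rightarrow\varphi\vee\psi^u,\Delta \Leftarrow \Gamma\Rightarrow\varphi^u,\psi^u,\Delta$; - $\to L$: $\Gamma,\varphi\to\psi^u\Rightarrow\Delta \Leftarrow \Gamma\Rightarrow\varphi^u,\Delta$ and $\Gamma,\psi^u\Rightarrow\Delta$; $\to R$: $\Gamma\Rightarrow\varphi\to\psi^u,\Delta \Leftarrow \Gamma,\varphi^u\Rightarrow\psi^u$; - $\mathsf u$: $\Gamma\Rightarrow\varphi^f,\Delta \Leftarrow \Gamma\Rightarrow\varphi^u,\Delta$; $\mathsf f$: $\Gamma\Rightarrow\varphi^u,\Delta \Leftarrow \Gamma\Rightarrow\varphi^f,\Delta$; - $CL$: $\Gamma,C\varphi^u\Rightarrow\Delta \Leftarrow \Gamma,\varphi^u,\{K_aC\varphi^u\}_{a\in A}\Rightarrow\Delta$; $CR$: $\Gamma\Rightarrow C\varphi^e,\Delta \Leftarrow \Gamma\Rightarrow\varphi^u,\Delta$ and $\Gamma\Rightarrow K_aC\varphi^e,\Delta$ for each $a\in A$ ($C\varphi^e$ is the principal formula);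 - $\mathsf K_a$: $\Pi,K_a\Gamma\Rightarrow K_a\varphi^e,\Sigma \Leftarrow \Gamma\Rightarrow\varphi^e$; $\mathsf T_a$: $\Gamma,K_a\varphi^u\Rightarrow\Delta \Leftarrow \Gamma,\varphi^u\Rightarrow\Delta$; $\mathsf{S4}_a$: $\Pi,K_a\Gamma\Rightarrow K_a\varphi^e,\Sigma \Leftarrow K_a\Gamma\Rightarrow\varphi^e$. $\mathrm{cICK}$ consists of all these rules except $\mathsf T_a,\mathsf{S4}_a$; $\mathrm{cICKT}$ is $\mathrm{cICK}$ plus all $\mathsf T_a$; $\mathrm{cICKS4}$ is $\mathrm{cICKT}$ with each $\mathsf K_a$ replaced by $\mathsf{S4}_a$. A *cyclic proof* of $\sigma$ in a calculus is a finite tree labelled by sequents, with root labelled $\sigma$, in which every non-leaf together with its children forms an instance of a rule of the calculus, and such that every leaf $l$ is labelled by an axiom or has a proper ancestor $c$ with the same label such that every sequent on the path from $c$ to $l$ has a formula in focus and the path passes through at least one instance of $CR$ with principal formula in focus. The closure of a formula is the smallest set containing it that is closed under: immediate subformulae of $\wedge,\vee,\to$; $K_a\psi\mapsto\psi$; and $C\psi\mapsto\psi$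 and $C\psi\mapsto K_aC\psi$ for all $a\in A$. The closure of a sequent is the union of the closures of its formulae (ignoring annotations). A rule is *analytic* if in each of its instances the closure of every premise is contained in the closure of the conclusion. **Theorem (Completeness of Cyclic Calculi).** Let $\sigma$ be a sequent. 1. If $\sigma$ is valid over the class of epistemic frames, then $\sigma$ has a cyclic proof in $\mathrm{cICK}$. 2. If $\sigma$ is valid over the class of reflexive frames, then $\sigma$ has a cyclic proof in $\mathrm{cICKT}$. 3. If $\sigma$ is valid over the class of S4 frames, then $\sigma$ has a cyclic proof in $\mathrm{cICKS4}$. Moreover, every rule of these three calculi is analytic. -/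

import Mathlib

universe u v w

namespace ICK

/-! ### Syntax -/

/-- Formulae over the agents `A` and the atomic propositions `P`. -/
inductive Formula (A : Type u) (P : Type v) : Type (max u v)
  | bot : Formula A P
  | atom : P → Formula A P
  | conj : Formula A P → Formula A P → Formula A P
  | disj : Formula A P → Formula A P → Formula A P
  | impl : Formula A P → Formula A P → Formula A P
  | know : A → Formula A P → Formula A P
  | common : Formula A P → Formula A P

noncomputable instance instDecidableEqFormula (A : Type u) (P : Type v) :
    DecidableEq (Formula A P) := Classical.decEq _

namespace Formula

variable {A : Type u} {P : Type v}

/-- Truth, `⊥ → ⊥`. -/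
def top : Formula A P := impl bot bot

/-- Conjunction of a finite list; the empty conjunction is `top`. -/
def bigConj : List (Formula A P) → Formula A P
  | [] => top
  | φ :: l => conj φ (bigConj l)

/-- Disjunction of a finite list; the empty disjunction is `bot`. -/
def bigDisj : List (Formula A P) → Formula A P
  | [] => bot
  | φ :: l => disj φ (bigDisj l)

/-- Closed sets of formulae. -/
structure Closed (S : Set (Formula A P)) : Prop where
  conj : ∀ φ ψ, Formula.conj φ ψ ∈ S → φ ∈ S ∧ ψ ∈ S
  disj : ∀ φ ψ, Formula.disj φ ψ ∈ S → φ ∈ S ∧ ψ ∈ S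
  impl : ∀ φ ψ, Formula.impl φ ψ ∈ S → φ ∈ S ∧ ψ ∈ S
  know : ∀ a φ, Formula.know a φ ∈ S → φ ∈ S
  common : ∀ φ, Formula.common φ ∈ S →
    φ ∈ S ∧ ∀ a, Formula.know a (Formula.common φ) ∈ S

/-- The closure of a formula: the smallest closed set containing it. -/
def closure (φ : Formula A P) : Set (Formula A P) :=
  ⋂₀ {S | Closed S ∧ φ ∈ S}

end Formula

/-! ### Semantics -/

/-- Birelational frames: a non-empty poset with one binary relation for each agent. -/
structure BirelationalFrame (A : Type u) where
  World : Type w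
  [nonempty : Nonempty World]
  [order : PartialOrder World]
  R : A → World → World → Prop

attribute [instance] BirelationalFrame.nonempty BirelationalFrame.order

/-- Epistemic frames: every accessibility relation is triangle confluent. -/
def epistemicFrames (A : Type u) : Set (BirelationalFrame.{u, w} A) :=
  {F | ∀ (a : A) (x y z : F.World), x ≤ y → F.R a y z → F.R a x z}

/-- Reflexive (epistemic) frames. -/
def reflexiveFrames (A : Type u) : Set (BirelationalFrame.{u, w} A) :=
  {F | F ∈ epistemicFrames A ∧ ∀ (a : A) (x : F.World), F.R a x x}

/-- S4 (epistemic) frames. -/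
def s4Frames (A : Type u) : Set (BirelationalFrame.{u, w} A) :=
  {F | F ∈ epistemicFrames A ∧ (∀ (a : A) (x : F.World), F.R a x x) ∧
    ∀ (a : A) (x y z : F.World), F.R a x y → F.R a y z → F.R a x z}

/-- Birelational models: a birelational frame with a monotone valuation. -/
structure BirelationalModel (A : Type u) (P : Type v) where
  frame : BirelationalFrame.{u, w} A
  V : frame.World → Set P
  V_mono : ∀ x y : frame.World, x ≤ y → V x ⊆ V y

/-- The truth relation. -/
def Sat {A : Type u} {P : Type v} (M : BirelationalModel.{u, v, w} A P) :
    M.frame.World → Formula A P → Prop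
  | _, .bot => False
  | x, .atom p => p ∈ M.V x
  | x, .conj φ ψ => Sat M x φ ∧ Sat M x ψ
  | x, .disj φ ψ => Sat M x φ ∨ Sat M x ψ
  | x, .impl φ ψ => ∀ y, x ≤ y → Sat M y φ → Sat M y ψ
  | x, .know a φ => ∀ y, M.frame.R a x y → Sat M y φ
  | x, .common φ =>
      ∀ y, Relation.ReflTransGen (fun s t => ∃ a, M.frame.R a s t) x y → Sat M y φ

/-- Validity of a formula over a class of frames. -/
def ValidFormula {A : Type u} {P : Type v} (𝓕 : Set (BirelationalFrame.{u, w} A))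
    (φ : Formula A P) : Prop :=
  ∀ M : BirelationalModel.{u, v, w} A P, M.frame ∈ 𝓕 → ∀ x : M.frame.World, Sat M x φ

/-! ### Annotated formulae and sequents -/

/-- Annotations: unfocused (`u`) and in focus (`f`). -/
inductive Ann
  | u
  | f
  deriving DecidableEq

/-- Annotated formulae. -/
abbrev AFormula (A : Type u) (P : Type v) : Type (max u v) := Formula A P × Ann

/-- Ordered pairs of finite sets of annotated formulae. -/
@[ext] structure SeqPair (A : Type u) (P : Type v) where
  left : Finset (AFormula A P)
  right : Finset (AFormula A P)

/-- Sequents. -/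
structure Sequent (A : Type u) (P : Type v) extends SeqPair A P where
  left_unfocused : ∀ x ∈ left, x.2 = Ann.u
  right_focus_unique : ∀ x ∈ right, ∀ y ∈ right, x.2 = Ann.f → y.2 = Ann.f → x = y
  right_focus_shape : ∀ x ∈ right, x.2 = Ann.f →
    (∃ ψ, x.1 = Formula.common ψ) ∨ ∃ a ψ, x.1 = Formula.know a (Formula.common ψ)

section

variable {A : Type u} {P : Type v}

/-- Erasing the annotations of a finite set of annotated formulae. -/
noncomputable def plain (Γ : Finset (AFormula A P)) : Finset (Formula A P) :=
  Γ.image Prod.fst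

/-- The interpretation `⋀ Γ⁻ → ⋁ Δ⁻` of a sequent. -/
noncomputable def Sequent.interp (σ : Sequent A P) : Formula A P :=
  .impl (.bigConj (plain σ.left).toList) (.bigDisj (plain σ.right).toList)

/-- Validity of a sequent over a class of frames. -/
def Sequent.Valid (𝓕 : Set (BirelationalFrame.{u, w} A)) (σ : Sequent A P) : Prop :=
  ValidFormula 𝓕 σ.interp

/-- The closure of a sequent. -/
def SeqPair.closure (s : SeqPair A P) : Set (Formula A P) :=
  {χ | ∃ φ ∈ plain s.left ∪ plain s.right, χ ∈ φ.closure}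

/-- Some formula of the sequent is in focus. -/
def SeqPair.HasFocus (s : SeqPair A P) : Prop := ∃ x ∈ s.right, x.2 = Ann.f

/-- `K_a Γ`, keeping annotations. -/
noncomputable def knowSet (a : A) (Γ : Finset (AFormula A P)) : Finset (AFormula A P) :=
  Γ.image fun x => (Formula.know a x.1, x.2)

end

/-! ### Rules and calculi -/

/-- Names of the rules; `knowT a` and `knowS4 a` are the rules `T_a` and `S4_a`. -/
inductive RuleName (A : Type u)
  | id | bot
  | conjL | conjR | disjL | disjR | implL | implR
  | unfocus | focus
  | know (a : A) | knowT (a : A) | knowS4 (a : A)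
  | commonL | commonR

section

variable {A : Type u} [Fintype A] {P : Type v}

/-- The premises of the right unfolding rule for `common φ` annotated by `e`: one for `φ` and
one for each agent. -/
noncomputable def commonRPremises (Γ Δ : Finset (AFormula A P)) (φ : Formula A P) (e : Ann) :
    List (SeqPair A P) :=
  ⟨Γ, insert (φ, Ann.u) Δ⟩ ::
    (Finset.univ : Finset A).toList.map fun a =>
      ⟨Γ, insert (Formula.know a (Formula.common φ), e) Δ⟩

/-- `RuleInst r s ps`: the conclusion `s` and the list of premises `ps` have the form of the
rule `r`. Side formulae may coincide with principal or residual ones. -/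
inductive RuleInst : RuleName A → SeqPair A P → List (SeqPair A P) → Prop
  | id (Γ Δ : Finset (AFormula A P)) (φ : Formula A P) (e : Ann) :
      RuleInst .id ⟨insert (φ, Ann.u) Γ, insert (φ, e) Δ⟩ []
  | bot (Γ Δ : Finset (AFormula A P)) :
      RuleInst .bot ⟨insert (Formula.bot, Ann.u) Γ, Δ⟩ []
  | conjL (Γ Δ : Finset (AFormula A P)) (φ ψ : Formula A P) :
      RuleInst .conjL ⟨insert (φ.conj ψ, Ann.u) Γ, Δ⟩
        [⟨insert (φ, Ann.u) (insert (ψ, Ann.u) Γ), Δ⟩]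
  | conjR (Γ Δ : Finset (AFormula A P)) (φ ψ : Formula A P) :
      RuleInst .conjR ⟨Γ, insert (φ.conj ψ, Ann.u) Δ⟩
        [⟨Γ, insert (φ, Ann.u) Δ⟩, ⟨Γ, insert (ψ, Ann.u) Δ⟩]
  | disjL (Γ Δ : Finset (AFormula A P)) (φ ψ : Formula A P) :
      RuleInst .disjL ⟨insert (φ.disj ψ, Ann.u) Γ, Δ⟩
        [⟨insert (φ, Ann.u) Γ, Δ⟩, ⟨insert (ψ, Ann.u) Γ, Δ⟩]
  | disjR (Γ Δ : Finset (AFormula A P)) (φ ψ : Formula A P) :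
      RuleInst .disjR ⟨Γ, insert (φ.disj ψ, Ann.u) Δ⟩
        [⟨Γ, insert (φ, Ann.u) (insert (ψ, Ann.u) Δ)⟩]
  | implL (Γ Δ : Finset (AFormula A P)) (φ ψ : Formula A P) :
      RuleInst .implL ⟨insert (φ.impl ψ, Ann.u) Γ, Δ⟩
        [⟨Γ, insert (φ, Ann.u) Δ⟩, ⟨insert (ψ, Ann.u) Γ, Δ⟩]
  | implR (Γ Δ : Finset (AFormula A P)) (φ ψ : Formula A P) :
      RuleInst .implR ⟨Γ, insert (φ.impl ψ, Ann.u) Δ⟩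
        [⟨insert (φ, Ann.u) Γ, {(ψ, Ann.u)}⟩]
  | unfocus (Γ Δ : Finset (AFormula A P)) (φ : Formula A P) :
      RuleInst .unfocus ⟨Γ, insert (φ, Ann.f) Δ⟩ [⟨Γ, insert (φ, Ann.u) Δ⟩]
  | focus (Γ Δ : Finset (AFormula A P)) (φ : Formula A P) :
      RuleInst .focus ⟨Γ, insert (φ, Ann.u) Δ⟩ [⟨Γ, insert (φ, Ann.f) Δ⟩]
  | know (a : A) (Γ Θ Ξ : Finset (AFormula A P)) (φ : Formula A P) (e : Ann) :
      RuleInst (.know a) ⟨Θ ∪ knowSet a Γ, insert (φ.know a, e) Ξ⟩ [⟨Γ, {(φ, e)}⟩]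
  | knowT (a : A) (Γ Δ : Finset (AFormula A P)) (φ : Formula A P) :
      RuleInst (.knowT a) ⟨insert (φ.know a, Ann.u) Γ, Δ⟩ [⟨insert (φ, Ann.u) Γ, Δ⟩]
  | knowS4 (a : A) (Γ Θ Ξ : Finset (AFormula A P)) (φ : Formula A P) (e : Ann) :
      RuleInst (.knowS4 a) ⟨Θ ∪ knowSet a Γ, insert (φ.know a, e) Ξ⟩
        [⟨knowSet a Γ, {(φ, e)}⟩]
  | commonL (Γ Δ : Finset (AFormula A P)) (φ : Formula A P) :
      RuleInst .commonL ⟨insert (φ.common, Ann.u) Γ, Δ⟩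
        [⟨insert (φ, Ann.u) (Γ ∪ Finset.univ.image fun a : A => (φ.common.know a, Ann.u)), Δ⟩]
  | commonR (Γ Δ : Finset (AFormula A P)) (φ : Formula A P) (e : Ann) :
      RuleInst .commonR ⟨Γ, insert (φ.common, e) Δ⟩ (commonRPremises Γ Δ φ e)

/-- Instances of the right unfolding rule in which the principal formula is in focus. -/
def FocusedCommonR (s : SeqPair A P) (ps : List (SeqPair A P)) : Prop :=
  ∃ (Γ Δ : Finset (AFormula A P)) (φ : Formula A P),
    s = ⟨Γ, insert (φ.common, Ann.f) Δ⟩ ∧ ps = commonRPremises Γ Δ φ Ann.f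

/-- Axioms: instances of one of the two rules without premises. -/
def IsAxiom (s : SeqPair A P) : Prop := RuleInst .id s [] ∨ RuleInst .bot s []

end

/-- The basic rules, together with the unfolding rules for common knowledge. -/
def baseRules (A : Type u) : Set (RuleName A) :=
  {.id, .bot, .conjL, .conjR, .disjL, .disjR, .implL, .implR, .unfocus, .focus,
    .commonL, .commonR}

/-- The rules of `cICK`. -/
def cICK (A : Type u) : Set (RuleName A) :=
  baseRules A ∪ Set.range RuleName.know

/-- The rules of `cICKT`. -/
def cICKT (A : Type u) : Set (RuleName A) :=
  cICK A ∪ Set.range RuleName.knowT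

/-- The rules of `cICKS4`. -/
def cICKS4 (A : Type u) : Set (RuleName A) :=
  (cICKT A \ Set.range RuleName.know) ∪ Set.range RuleName.knowS4

/-! ### Cyclic proofs -/

/-- Finite trees labelled by sequents. A node is given by its address, the list of child indices
leading to it from the root `[]`; the children of `x` are the nodes of the form `x ++ [i]`. Hence
there is a path from `x` to `y` if and only if `x` is a prefix of `y`, and the nodes on it are the
`z` with `x <+: z` and `z <+: y`. Only the labels of nodes of the tree matter. -/
structure SequentTree (A : Type u) (P : Type v) where
  nodes : Finset (List ℕ)
  root_mem : [] ∈ nodes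
  parent_mem : ∀ x i, x ++ [i] ∈ nodes → x ∈ nodes
  label : List ℕ → Sequent A P

namespace SequentTree

variable {A : Type u} {P : Type v}

/-- The node `x` has no children. -/
def IsLeaf (T : SequentTree A P) (x : List ℕ) : Prop := ∀ i, x ++ [i] ∉ T.nodes

/-- The children of `x` are labelled, in order, by the members of `ps`. -/
def ChildLabels (T : SequentTree A P) (x : List ℕ) (ps : List (SeqPair A P)) : Prop :=
  (∀ i, x ++ [i] ∈ T.nodes ↔ i < ps.length) ∧
    ∀ (i : ℕ) (h : i < ps.length), (T.label (x ++ [i])).toSeqPair = ps[i]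

variable [Fintype A]

/-- Cyclic pre-proofs of `σ` in the calculus with the set `C` of rules. -/
def IsPreProof (T : SequentTree A P) (C : Set (RuleName A)) (σ : Sequent A P) : Prop :=
  T.label [] = σ ∧
    ∀ x ∈ T.nodes, ¬ T.IsLeaf x →
      ∃ r ∈ C, ∃ ps, RuleInst r (T.label x).toSeqPair ps ∧ T.ChildLabels x ps

/-- The path from `x` to `y` is successful: every sequent on it has a formula in focus, and it
passes through an instance of the right unfolding rule with principal formula in focus. -/
def SuccessfulPath (T : SequentTree A P) (x y : List ℕ) : Prop :=
  (∀ z, x <+: z → z <+: y → (T.label z).HasFocus) ∧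
    ∃ z, x <+: z ∧ z <+: y ∧ z ≠ y ∧
      ∃ ps, FocusedCommonR (T.label z).toSeqPair ps ∧ T.ChildLabels z ps

/-- `(x, y)` is a successful repetition. -/
def SuccessfulRepetition (T : SequentTree A P) (x y : List ℕ) : Prop :=
  x ∈ T.nodes ∧ y ∈ T.nodes ∧ x ≠ y ∧ x <+: y ∧ T.label x = T.label y ∧ T.SuccessfulPath x y

/-- Cyclic proofs of `σ` in the calculus with the set `C` of rules. -/
def IsCyclicProof (T : SequentTree A P) (C : Set (RuleName A)) (σ : Sequent A P) : Prop :=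
  T.IsPreProof C σ ∧
    ∀ l ∈ T.nodes, T.IsLeaf l →
      IsAxiom (T.label l).toSeqPair ∨ ∃ c, T.SuccessfulRepetition c l

end SequentTree

section

variable {A : Type u} [Fintype A]

/-- The sequent `σ` has a cyclic proof in the calculus with the set `C` of rules. -/
def HasCyclicProof {P : Type v} (C : Set (RuleName A)) (σ : Sequent A P) : Prop :=
  ∃ T : SequentTree A P, T.IsCyclicProof C σ

/-- The rule `r` is analytic (over the atomic propositions `P`): in each of its instances, the
closure of every premise is contained in the closure of the conclusion. -/
def RuleName.Analytic (P : Type v) (r : RuleName A) : Prop :=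
  ∀ (s : SeqPair A P) (ps : List (SeqPair A P)), RuleInst r s ps →
    ∀ p ∈ ps, p.closure ⊆ s.closure

end

end ICK

namespace ICK

variable {A : Type u} {P : Type v}

/-! ### Analyticity -/

/-! Completeness comes from a canonical model built inside a finite closed set `S` of formulae
containing those of an underivable sequent. Among pairs of subsets of `S`, a maximal underivable one
is saturated under the invertible rules (`Derivable.of_saturated`), and the saturated underivable
pairs serve as worlds: the left side is to be true, the right side false. Agent `a` passes from one
world to another when the second contains `N a` of the left side of the first, where `N a` is what
the modal rule keeps in its premise. Abstracting over `N` in `Calculus` treats the three calculi at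
once.

The truth lemma is routine except for `C φ` on the right of a world `w`, which requires a reachable
world with `φ` on the right. If there is none, a cyclic proof is constructed
(`World.derivable_common`). Put `C φ` in focus, saturate, and unfold. The premise with `φ` is
derivable, since otherwise it would extend to a reachable world refuting `φ`. The premise with `K_a
C φ` goes, by the modal rule, to a sequent of the original shape, with the focus intact. Only
finitely many saturated sequents are available, so each branch eventually repeats one, and an
unfolding in focus lies between the two occurrences.

Cycles are handled by an inductive predicate carrying the set of available companions, which
`Derivable.exists_tree` turns into actual trees. Analyticity is a check of each rule against the
closure conditions. -/

theorem Formula.self_mem_closure (φ : Formula A P) : φ ∈ φ.closure :=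
  Set.mem_sInter.2 fun _ h => h.2

theorem SeqPair.mem_closure_of_mem_left {s : SeqPair A P} {x : AFormula A P} (h : x ∈ s.left) :
    x.1 ∈ s.closure :=
  ⟨x.1, Finset.mem_union_left _ (Finset.mem_image_of_mem _ h), x.1.self_mem_closure⟩

theorem SeqPair.mem_closure_of_mem_right {s : SeqPair A P} {x : AFormula A P} (h : x ∈ s.right) :
    x.1 ∈ s.closure :=
  ⟨x.1, Finset.mem_union_right _ (Finset.mem_image_of_mem _ h), x.1.self_mem_closure⟩

theorem Formula.closed_closure (φ : Formula A P) : Formula.Closed φ.closure where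
  conj _ _ h := ⟨fun S hS => (hS.1.conj _ _ (h S hS)).1, fun S hS => (hS.1.conj _ _ (h S hS)).2⟩
  disj _ _ h := ⟨fun S hS => (hS.1.disj _ _ (h S hS)).1, fun S hS => (hS.1.disj _ _ (h S hS)).2⟩
  impl _ _ h := ⟨fun S hS => (hS.1.impl _ _ (h S hS)).1, fun S hS => (hS.1.impl _ _ (h S hS)).2⟩
  know _ _ h := fun S hS => hS.1.know _ _ (h S hS)
  common _ h := ⟨fun S hS => (hS.1.common _ (h S hS)).1,
    fun a S hS => (hS.1.common _ (h S hS)).2 a⟩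

theorem Formula.closed_exists_mem {T : Set (Set (Formula A P))}
    (hT : ∀ S ∈ T, Formula.Closed S) : Formula.Closed (⋃₀ T) where
  conj _ _ := fun ⟨S, hS, h⟩ =>
    ⟨⟨S, hS, ((hT S hS).conj _ _ h).1⟩, ⟨S, hS, ((hT S hS).conj _ _ h).2⟩⟩
  disj _ _ := fun ⟨S, hS, h⟩ =>
    ⟨⟨S, hS, ((hT S hS).disj _ _ h).1⟩, ⟨S, hS, ((hT S hS).disj _ _ h).2⟩⟩
  impl _ _ := fun ⟨S, hS, h⟩ =>
    ⟨⟨S, hS, ((hT S hS).impl _ _ h).1⟩, ⟨S, hS, ((hT S hS).impl _ _ h).2⟩⟩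
  know _ _ := fun ⟨S, hS, h⟩ => ⟨S, hS, (hT S hS).know _ _ h⟩
  common _ := fun ⟨S, hS, h⟩ =>
    ⟨⟨S, hS, ((hT S hS).common _ h).1⟩, fun a => ⟨S, hS, ((hT S hS).common _ h).2 a⟩⟩

theorem Formula.Closed.union {S T : Set (Formula A P)} (hS : Formula.Closed S)
    (hT : Formula.Closed T) : Formula.Closed (S ∪ T) := by
  have := Formula.closed_exists_mem (T := {S, T}) (by simp [hS, hT])
  rwa [Set.sUnion_pair] at this

theorem SeqPair.closed_closure (s : SeqPair A P) : Formula.Closed s.closure := by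
  have h : s.closure = ⋃₀ (Formula.closure '' {φ | φ ∈ plain s.left ∪ plain s.right}) := by
    ext χ
    simp [SeqPair.closure]
  rw [h]
  exact Formula.closed_exists_mem (by rintro _ ⟨φ, -, rfl⟩; exact φ.closed_closure)

theorem SeqPair.closure_subset {s : SeqPair A P} {S : Set (Formula A P)} (hS : Formula.Closed S)
    (hl : ∀ x ∈ s.left, x.1 ∈ S) (hr : ∀ x ∈ s.right, x.1 ∈ S) : s.closure ⊆ S := by
  rintro χ ⟨φ, hφ, hχ⟩
  refine hχ S ⟨hS, ?_⟩
  rcases Finset.mem_union.1 hφ with h | h <;> obtain ⟨x, hx, rfl⟩ := Finset.mem_image.1 h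
  exacts [hl x hx, hr x hx]

theorem RuleName.analytic [Fintype A] (r : RuleName A) : r.Analytic P := by
  intro s ps h p hp
  have hS := s.closed_closure
  have hl : ∀ x ∈ s.left, x.1 ∈ s.closure := fun _ => SeqPair.mem_closure_of_mem_left
  have hr : ∀ x ∈ s.right, x.1 ∈ s.closure := fun _ => SeqPair.mem_closure_of_mem_right
  -- Only two facts about the closure matter: it is closed, and it contains the formulae of the
  -- conclusion.
  generalize s.closure = S at hS hl hr
  apply SeqPair.closure_subset hS
  all_goals
    cases h
    all_goals
      simp only [commonRPremises, knowSet, List.mem_cons, List.not_mem_nil, or_false,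
        List.mem_map, Finset.mem_insert, Finset.mem_union, Finset.mem_image, forall_eq_or_imp] at hl hr hp
    all_goals
      have := hS.conj
      have := hS.disj
      have := hS.impl
      have := hS.know
      have := hS.common
      try rcases hp with rfl | hp
      all_goals first
        | obtain ⟨a, -, rfl⟩ := hp
        | subst hp
        | skip
      all_goals
        simp only [Finset.mem_insert, Finset.mem_union, Finset.mem_image,
          Finset.mem_singleton]
        -- In the modal rules, a member of `Γ` enters the closure through its boxed copy in the
        -- conclusion.
        try have hl' := fun x hx => hl _ (Or.inr ⟨x, hx, rfl⟩)
        grind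

/-! ### Sequents -/

/-- The pair `s` satisfies the side conditions of a sequent. -/
def SeqPair.IsSequent (s : SeqPair A P) : Prop := ∃ σ : Sequent A P, σ.toSeqPair = s

theorem Sequent.toSeqPair_injective :
    Function.Injective (Sequent.toSeqPair : Sequent A P → SeqPair A P) := by
  rintro ⟨⟩ ⟨⟩ h
  cases h
  rfl

/-- Annotate all formulae as unfocused. -/
noncomputable def unfocused (Γ : Finset (Formula A P)) : Finset (AFormula A P) :=
  Γ.image fun φ => (φ, Ann.u)

/-- The sequent with unfocused formulae `Γ` on the left and `Δ` on the right, together with the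
annotated formulae `F` on the right. -/
noncomputable def seq (Γ Δ : Finset (Formula A P)) (F : Finset (AFormula A P)) : SeqPair A P :=
  ⟨unfocused Γ, unfocused Δ ∪ F⟩

/-- At most one formula, in focus and of an admissible shape. -/
def IsFocus (F : Finset (AFormula A P)) : Prop :=
  F = ∅ ∨ ∃ χ : Formula A P,
    ((∃ ψ, χ = .common ψ) ∨ ∃ a ψ, χ = .know a (.common ψ)) ∧ F = {(χ, Ann.f)}

/-- The formulae known by `a` according to `Γ`. -/
noncomputable def unknow (a : A) (Γ : Finset (Formula A P)) : Finset (Formula A P) :=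
  Γ.preimage (Formula.know a) fun _ _ _ _ h => (Formula.know.inj h).2

section

variable {Γ Δ S : Finset (Formula A P)} {F : Finset (AFormula A P)} {φ ψ : Formula A P} {a : A}

theorem mem_unfocused {x : AFormula A P} : x ∈ unfocused Γ ↔ x.1 ∈ Γ ∧ x.2 = Ann.u := by
  obtain ⟨φ, e⟩ := x
  simp [unfocused, eq_comm]

theorem unfocused_insert : unfocused (insert φ Γ) = insert (φ, Ann.u) (unfocused Γ) :=
  Finset.image_insert _ _ _

theorem insert_unfocused (h : φ ∈ Γ) : insert (φ, Ann.u) (unfocused Γ) = unfocused Γ :=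
  Finset.insert_eq_of_mem (mem_unfocused.2 ⟨h, rfl⟩)

theorem insert_unfocused_union (h : φ ∈ Δ) :
    insert (φ, Ann.u) (unfocused Δ ∪ F) = unfocused Δ ∪ F :=
  Finset.insert_eq_of_mem (Finset.mem_union_left _ (mem_unfocused.2 ⟨h, rfl⟩))

theorem seq_insert_left :
    seq (insert φ Γ) Δ F = ⟨insert (φ, Ann.u) (unfocused Γ), unfocused Δ ∪ F⟩ := by
  rw [seq, unfocused_insert]

theorem seq_insert_right :
    seq Γ (insert φ Δ) F = ⟨unfocused Γ, insert (φ, Ann.u) (unfocused Δ ∪ F)⟩ := by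
  rw [seq, unfocused_insert, Finset.insert_union]

theorem mem_unknow : φ ∈ unknow a Γ ↔ .know a φ ∈ Γ := Finset.mem_preimage

theorem seq_isSequent (hF : IsFocus F) : (seq Γ Δ F).IsSequent := by
  have hu : ∀ x ∈ unfocused Δ ∪ F, x.2 = Ann.f → x ∈ F := fun x hx hf => by
    rcases Finset.mem_union.1 hx with h | h
    · rw [(mem_unfocused.1 h).2] at hf
      cases hf
    · exact h
  refine ⟨⟨seq Γ Δ F, fun x hx => (mem_unfocused.1 hx).2, ?_, ?_⟩, rfl⟩
  · intro x hx y hy hxf hyf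
    have hx := hu x hx hxf
    have hy := hu y hy hyf
    rcases hF with rfl | ⟨χ, -, rfl⟩
    · simp at hx
    · rw [Finset.mem_singleton.1 hx, Finset.mem_singleton.1 hy]
  · intro x hx hxf
    have hx := hu x hx hxf
    rcases hF with rfl | ⟨χ, hχ, rfl⟩
    · simp at hx
    · rw [Finset.mem_singleton.1 hx]
      exact hχ

theorem seq_singleton_unfocused (φ : Formula A P) :
    seq Γ {φ} ∅ = ⟨unfocused Γ, {(φ, Ann.u)}⟩ := by
  simp [seq, unfocused]

theorem seq_empty (x : AFormula A P) : seq Γ ∅ {x} = ⟨unfocused Γ, {x}⟩ := by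
  simp [seq, unfocused]

theorem isFocus_empty : IsFocus (∅ : Finset (AFormula A P)) := .inl rfl

theorem isFocus_common (φ : Formula A P) : IsFocus {(φ.common, Ann.f)} :=
  .inr ⟨_, .inl ⟨_, rfl⟩, rfl⟩

theorem isFocus_know_common (a : A) (φ : Formula A P) : IsFocus {(φ.common.know a, Ann.f)} :=
  .inr ⟨_, .inr ⟨_, _, rfl⟩, rfl⟩

end

theorem knowSet_unfocused (a : A) (Γ : Finset (Formula A P)) :
    knowSet a (unfocused Γ) = unfocused (Γ.image (Formula.know a)) := by
  simp [knowSet, unfocused, Finset.image_image, Function.comp_def]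

theorem image_know_unknow_subset (a : A) (Γ : Finset (Formula A P)) :
    (unknow a Γ).image (Formula.know a) ⊆ Γ :=
  Finset.image_subset_iff.2 fun _ h => mem_unknow.1 h

/-- The weakening context of a modal rule may be all of `Γ`; the boxed formulae then occur twice and
merge, so any left side fits the conclusion of the rule. -/
theorem unfocused_union_knowSet (a : A) (Γ : Finset (Formula A P)) :
    unfocused Γ ∪ knowSet a (unfocused (unknow a Γ)) = unfocused Γ := by
  rw [knowSet_unfocused]
  exact Finset.union_eq_left.2 (Finset.image_subset_image (image_know_unknow_subset a Γ))

theorem Sequent.left_eq (σ : Sequent A P) : σ.left = unfocused (plain σ.left) := by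
  ext x
  simp only [mem_unfocused, plain, Finset.mem_image]
  constructor
  · exact fun h => ⟨⟨x, h, rfl⟩, σ.left_unfocused x h⟩
  · rintro ⟨⟨y, hy, hyx⟩, hx⟩
    rwa [← Prod.ext hyx ((σ.left_unfocused y hy).trans hx.symm)]

section

variable {M : BirelationalModel.{u, v, w} A P} {x : M.frame.World}

theorem sat_bigConj {l : List (Formula A P)} :
    Sat M x (.bigConj l) ↔ ∀ φ ∈ l, Sat M x φ := by
  induction l with
  | nil => simp [Formula.bigConj, Formula.top, Sat]
  | cons φ l ih => simp [Formula.bigConj, Sat, ih]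

theorem sat_bigDisj {l : List (Formula A P)} :
    Sat M x (.bigDisj l) ↔ ∃ φ ∈ l, Sat M x φ := by
  induction l with
  | nil => simp [Formula.bigDisj, Sat]
  | cons φ l ih => simp [Formula.bigDisj, Sat, ih]

end

/-! ### Trees -/

namespace SequentTree

/-- The tree with a single node. -/
def single (σ : Sequent A P) : SequentTree A P where
  nodes := {[]}
  root_mem := by simp
  parent_mem := by simp
  label _ := σ

/-- The tree with root labelled `σ` and immediate subtrees `T i` for `i < n`. -/
def graft (σ : Sequent A P) (n : ℕ) (T : ℕ → SequentTree A P) : SequentTree A P where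
  nodes := insert [] ((Finset.range n).biUnion fun i => (T i).nodes.image (List.cons i))
  root_mem := by simp
  parent_mem x i h := by
    cases x with
    | nil => simp
    | cons j x =>
      simp only [List.cons_append, Finset.mem_insert, reduceCtorEq, Finset.mem_biUnion,
        Finset.mem_range, Finset.mem_image, List.cons.injEq, false_or] at h ⊢
      obtain ⟨k, hk, y, hy, rfl, rfl⟩ := h
      exact ⟨k, hk, x, (T k).parent_mem x i hy, rfl, rfl⟩
  label
    | [] => σ
    | i :: x => (T i).label x

variable {σ : Sequent A P} {n : ℕ} {T : ℕ → SequentTree A P}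

theorem cons_mem_graft {i : ℕ} {x : List ℕ} :
    i :: x ∈ (graft σ n T).nodes ↔ i < n ∧ x ∈ (T i).nodes := by
  simp only [graft, Finset.mem_insert, reduceCtorEq, Finset.mem_biUnion, Finset.mem_range,
    Finset.mem_image, List.cons.injEq, false_or]
  constructor
  · rintro ⟨k, hk, y, hy, rfl, rfl⟩
    exact ⟨hk, hy⟩
  · rintro ⟨hi, hx⟩
    exact ⟨i, hi, x, hx, rfl, rfl⟩

theorem isLeaf_of_graft {i : ℕ} {x : List ℕ} (hi : i < n) (h : (graft σ n T).IsLeaf (i :: x)) :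
    (T i).IsLeaf x :=
  fun j hj => h j (cons_mem_graft.2 ⟨hi, hj⟩)

theorem ChildLabels.graft {i : ℕ} {x : List ℕ} {ps : List (SeqPair A P)} (hi : i < n)
    (h : (T i).ChildLabels x ps) : (graft σ n T).ChildLabels (i :: x) ps :=
  ⟨fun j => by rw [← h.1 j, List.cons_append, cons_mem_graft]; simp [hi], h.2⟩

theorem childLabels_graft_root {ps : List (SeqPair A P)}
    (h : ∀ (i : ℕ) (hi : i < ps.length), ((T i).label []).toSeqPair = ps[i]) :
    (SequentTree.graft σ ps.length T).ChildLabels [] ps :=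
  ⟨fun i => by
    rw [List.nil_append, cons_mem_graft]
    simp [(T i).root_mem], h⟩

end SequentTree

/-! ### Derivations with companions -/

variable [Fintype A]

/-- `Derivable C L s`: the sequent `s` has a cyclic derivation in which leaves may also be labelled
by members of `L`, provided that all sequents on the path from the root are in focus. -/
inductive Derivable (C : Set (RuleName A)) : Set (SeqPair A P) → SeqPair A P → Prop
  | ax {L s} (hs : s.IsSequent) (h : IsAxiom s) : Derivable C L s
  | loop {L s} (hs : s.IsSequent) (hf : s.HasFocus) (h : s ∈ L) : Derivable C L s
  -- Shrinking to `L'` models loss of focus: a conclusion without focus passes no companions on to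
  -- its premises.
  | step {L L' s r ps} (hs : s.IsSequent) (hr : r ∈ C) (h : RuleInst r s ps) (hps : ps ≠ [])
      (hL : L' ⊆ L) (hf : L'.Nonempty → s.HasFocus) (hd : ∀ p ∈ ps, Derivable C L' p) :
      Derivable C L s
  | unfold {L s ps} (hs : s.IsSequent) (hr : .commonR ∈ C) (h : FocusedCommonR s ps)
      (hd : ∀ p ∈ ps, Derivable C (insert s L) p) : Derivable C L s

theorem Derivable.mono {C : Set (RuleName A)} {L L' : Set (SeqPair A P)} {s : SeqPair A P}
    (h : Derivable C L s) (hL : L ⊆ L') : Derivable C L' s := by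
  induction h generalizing L' with
  | ax hs h => exact .ax hs h
  | loop hs hf h => exact .loop hs hf (hL h)
  | step hs hr h hps hL₀ hf hd => exact .step hs hr h hps (hL₀.trans hL) hf hd
  | unfold hs hr h _ ih => exact .unfold hs hr h fun p hp => ih p hp (Set.insert_subset_insert hL)

namespace SequentTree

variable {σ : Sequent A P} {n : ℕ} {T : ℕ → SequentTree A P}

theorem SuccessfulRepetition.graft {i : ℕ} {c l : List ℕ} (hi : i < n)
    (h : (T i).SuccessfulRepetition c l) :
    (SequentTree.graft σ n T).SuccessfulRepetition (i :: c) (i :: l) := by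
  obtain ⟨hc, hl, hne, hp, he, hf, z, hcz, hzl, hz, ps, hps, hch⟩ := h
  refine ⟨cons_mem_graft.2 ⟨hi, hc⟩, cons_mem_graft.2 ⟨hi, hl⟩, by simpa using hne,
    by simpa using hp, he, ?_, i :: z, by simpa using hcz, by simpa using hzl, by simpa using hz,
    ps, hps, hch.graft hi⟩
  rintro (_ | ⟨j, y⟩) hcy hyl
  · simp at hcy
  · obtain ⟨rfl, hcy'⟩ := List.cons_prefix_cons.1 hcy
    exact hf y hcy' (List.cons_prefix_cons.1 hyl).2

theorem IsPreProof.graft {C : Set (RuleName A)} {r : RuleName A} {ps : List (SeqPair A P)}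
    (hr : r ∈ C) (hi : RuleInst r σ.toSeqPair ps)
    (hroot : ∀ (i : ℕ) (hi : i < ps.length), ((T i).label []).toSeqPair = ps[i])
    (hT : ∀ i < ps.length, (T i).IsPreProof C ((T i).label [])) :
    (SequentTree.graft σ ps.length T).IsPreProof C σ := by
  refine ⟨rfl, ?_⟩
  rintro (_ | ⟨i, x⟩) hx hleaf
  · exact ⟨r, hr, ps, hi, childLabels_graft_root hroot⟩
  · obtain ⟨hin, hx⟩ := cons_mem_graft.1 hx
    have hnl : ¬ (T i).IsLeaf x := fun h => hleaf fun j hj =>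
      h j (cons_mem_graft.1 hj).2
    obtain ⟨r', hr', qs, hq, hc⟩ := (hT i hin).2 x hx hnl
    exact ⟨r', hr', qs, hq, hc.graft hin⟩

/-- Cyclic pre-proofs whose leaves are axioms, successful repetitions, or labelled by members of
`L` and connected to the root by a path of sequents in focus. -/
def IsOpenProof (T : SequentTree A P) (C : Set (RuleName A)) (L : Set (SeqPair A P)) : Prop :=
  T.IsPreProof C (T.label []) ∧ ∀ l ∈ T.nodes, T.IsLeaf l →
    IsAxiom (T.label l).toSeqPair ∨ (∃ c, T.SuccessfulRepetition c l) ∨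
      ((T.label l).toSeqPair ∈ L ∧ ∀ z, z <+: l → (T.label z).HasFocus)

theorem IsOpenProof.single {C : Set (RuleName A)} {L : Set (SeqPair A P)}
    (h : IsAxiom σ.toSeqPair ∨ σ.toSeqPair ∈ L ∧ σ.HasFocus) :
    (SequentTree.single σ).IsOpenProof C L := by
  refine ⟨⟨rfl, fun x hx hl => (hl fun i hi => ?_).elim⟩, fun l _ _ => ?_⟩
  · simp [SequentTree.single] at hi
  · rcases h with h | h
    · exact .inl h
    · exact .inr (.inr ⟨h.1, fun _ _ => h.2⟩)

/-- Common core of `Derivable.step` and `Derivable.unfold`. The focus condition omits the root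
because the two cases secure its focus for different reasons. -/
theorem exists_graft {C : Set (RuleName A)} {L : Set (SeqPair A P)} {r : RuleName A}
    {ps : List (SeqPair A P)} (hr : r ∈ C) (hi : RuleInst r σ.toSeqPair ps) (hps : ps ≠ [])
    (h : ∀ p ∈ ps, ∃ T : SequentTree A P, (T.label []).toSeqPair = p ∧ T.IsOpenProof C L) :
    ∃ T : SequentTree A P, T.IsPreProof C σ ∧ T.ChildLabels [] ps ∧
      ∀ l ∈ T.nodes, T.IsLeaf l →
        l ≠ [] ∧ (IsAxiom (T.label l).toSeqPair ∨ (∃ c, T.SuccessfulRepetition c l) ∨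
          ((T.label l).toSeqPair ∈ L ∧ ∀ z, z <+: l → z ≠ [] → (T.label z).HasFocus)) := by
  have h' : ∀ i, ∃ T : SequentTree A P, ∀ hi : i < ps.length,
      (T.label []).toSeqPair = ps[i] ∧ T.IsOpenProof C L := fun i => by
    by_cases hi : i < ps.length
    · obtain ⟨T, hT⟩ := h ps[i] (List.getElem_mem hi)
      exact ⟨T, fun _ => hT⟩
    · exact ⟨SequentTree.single σ, fun hi' => (hi hi').elim⟩
  choose T hT using h'
  refine ⟨SequentTree.graft σ ps.length T, .graft hr hi (fun i hi => (hT i hi).1)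
    fun i hi => (hT i hi).2.1, childLabels_graft_root fun i hi => (hT i hi).1, ?_⟩
  rintro (_ | ⟨i, x⟩) hx hleaf
  · refine (hleaf 0 (cons_mem_graft.2 ⟨List.length_pos_iff.2 hps, (T 0).root_mem⟩)).elim
  · obtain ⟨hin, hx⟩ := cons_mem_graft.1 hx
    refine ⟨by simp, ?_⟩
    rcases (hT i hin).2.2 x hx (isLeaf_of_graft hin hleaf) with h | ⟨c, hc⟩ | ⟨h, hf⟩
    · exact .inl h
    · exact .inr (.inl ⟨_, hc.graft hin⟩)
    · refine .inr (.inr ⟨h, ?_⟩)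
      rintro (_ | ⟨j, z⟩) hz hne
      · exact (hne rfl).elim
      · obtain ⟨rfl, hz'⟩ := List.cons_prefix_cons.1 hz
        exact hf z hz'

end SequentTree

theorem FocusedCommonR.hasFocus {s : SeqPair A P} {ps : List (SeqPair A P)}
    (h : FocusedCommonR s ps) : s.HasFocus := by
  obtain ⟨Γ, Δ, φ, rfl, -⟩ := h
  exact ⟨_, Finset.mem_insert_self _ _, rfl⟩

/-- The companion set is discharged at unfoldings: an open leaf carrying the label just unfolded
becomes a repetition whose companion is the root of the current tree. -/
theorem Derivable.exists_tree {C : Set (RuleName A)} {L : Set (SeqPair A P)} {s : SeqPair A P}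
    (h : Derivable C L s) :
    ∃ T : SequentTree A P, (T.label []).toSeqPair = s ∧ T.IsOpenProof C L := by
  induction h with
  | ax hs h =>
    obtain ⟨σ, rfl⟩ := hs
    exact ⟨.single σ, rfl, .single (.inl h)⟩
  | loop hs hf h =>
    obtain ⟨σ, rfl⟩ := hs
    exact ⟨.single σ, rfl, .single (.inr ⟨h, hf⟩)⟩
  | step hs hr h hps hL hf _ ih =>
    obtain ⟨σ, rfl⟩ := hs
    obtain ⟨T, hT, -, hl⟩ := SequentTree.exists_graft hr h hps ih
    obtain rfl := hT.1
    refine ⟨T, rfl, hT, fun l hln hlf => ?_⟩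
    obtain ⟨-, h | h | ⟨h, hz⟩⟩ := hl l hln hlf
    · exact .inl h
    · exact .inr (.inl h)
    · refine .inr (.inr ⟨hL h, fun z hzl => ?_⟩)
      by_cases hz0 : z = []
      · exact hz0 ▸ hf ⟨_, h⟩
      · exact hz z hzl hz0
  | unfold hs hr h _ ih =>
    obtain ⟨σ, rfl⟩ := hs
    have hfoc := h.hasFocus
    obtain ⟨Γ, Δ, φ, hσ, rfl⟩ := id h
    obtain ⟨T, hT, hc, hl⟩ := SequentTree.exists_graft hr
      (hσ ▸ RuleInst.commonR Γ Δ φ .f) (by simp [commonRPremises]) ih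
    obtain rfl := hT.1
    refine ⟨T, rfl, hT, fun l hln hlf => ?_⟩
    obtain ⟨hne, h' | h' | ⟨h', hz⟩⟩ := hl l hln hlf
    · exact .inl h'
    · exact .inr (.inl h')
    have hz' : ∀ z, z <+: l → (T.label z).HasFocus := fun z hzl => by
      by_cases hz0 : z = []
      · exact hz0 ▸ hfoc
      · exact hz z hzl hz0
    rcases h' with h' | h'
    -- The root is both the companion and the instance of `CR` in focus that the path needs.
    · exact .inr (.inl ⟨[], T.root_mem, hln, hne.symm, List.nil_prefix,
        (Sequent.toSeqPair_injective h').symm, fun z _ => hz' z,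
        [], List.prefix_rfl, List.nil_prefix, hne.symm, _, h, hc⟩)
    · exact .inr (.inr ⟨h', hz'⟩)

theorem Derivable.hasCyclicProof {C : Set (RuleName A)} {σ : Sequent A P}
    (h : Derivable C ∅ σ.toSeqPair) : HasCyclicProof C σ := by
  obtain ⟨T, hT, hp, hl⟩ := h.exists_tree
  obtain rfl := Sequent.toSeqPair_injective hT
  refine ⟨T, hp, fun l hln hlf => ?_⟩
  rcases hl l hln hlf with h | h | h
  · exact .inl h
  · exact .inr h
  · exact h.1.elim

/-! ### Finite closed sets -/

/-- Induction on the formula; the finiteness of `A` is what keeps the case of `C` finite. -/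
theorem Formula.exists_finset_closed (φ : Formula A P) :
    ∃ S : Finset (Formula A P), Formula.Closed (S : Set (Formula A P)) ∧ φ ∈ S := by
  have key : ∀ (φ : Formula A P) (S : Finset (Formula A P)),
      Formula.Closed (S : Set (Formula A P)) →
      (∀ ψ χ, φ = .conj ψ χ → ψ ∈ S ∧ χ ∈ S) → (∀ ψ χ, φ = .disj ψ χ → ψ ∈ S ∧ χ ∈ S) →
      (∀ ψ χ, φ = .impl ψ χ → ψ ∈ S ∧ χ ∈ S) → (∀ a ψ, φ = .know a ψ → ψ ∈ S) →
      (∀ ψ, φ ≠ .common ψ) →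
      ∃ S : Finset (Formula A P), Formula.Closed (S : Set (Formula A P)) ∧ φ ∈ S := by
    intro φ S hS h1 h2 h3 h4 h5
    refine ⟨insert φ S, ⟨?_, ?_, ?_, ?_, ?_⟩, Finset.mem_insert_self _ _⟩ <;>
      simp only [Finset.mem_coe, Finset.mem_insert]
    · rintro ψ χ (h | h)
      · exact ⟨.inr (h1 _ _ h.symm).1, .inr (h1 _ _ h.symm).2⟩
      · exact ⟨.inr (hS.conj _ _ h).1, .inr (hS.conj _ _ h).2⟩
    · rintro ψ χ (h | h)
      · exact ⟨.inr (h2 _ _ h.symm).1, .inr (h2 _ _ h.symm).2⟩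
      · exact ⟨.inr (hS.disj _ _ h).1, .inr (hS.disj _ _ h).2⟩
    · rintro ψ χ (h | h)
      · exact ⟨.inr (h3 _ _ h.symm).1, .inr (h3 _ _ h.symm).2⟩
      · exact ⟨.inr (hS.impl _ _ h).1, .inr (hS.impl _ _ h).2⟩
    · rintro a ψ (h | h)
      · exact .inr (h4 _ _ h.symm)
      · exact .inr (hS.know _ _ h)
    · rintro ψ (h | h)
      · exact (h5 _ h.symm).elim
      · exact ⟨.inr (hS.common _ h).1, fun a => .inr ((hS.common _ h).2 a)⟩
  have hempty : Formula.Closed ((∅ : Finset (Formula A P)) : Set (Formula A P)) := by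
    constructor <;> simp
  have hunion : ∀ {ψ χ : Formula A P},
      (∃ S : Finset (Formula A P), Formula.Closed (S : Set (Formula A P)) ∧ ψ ∈ S) →
      (∃ S : Finset (Formula A P), Formula.Closed (S : Set (Formula A P)) ∧ χ ∈ S) →
      ∃ S : Finset (Formula A P), Formula.Closed (S : Set (Formula A P)) ∧ ψ ∈ S ∧ χ ∈ S := by
    rintro ψ χ ⟨S, hS, hψ⟩ ⟨T, hT, hχ⟩
    exact ⟨S ∪ T, by rw [Finset.coe_union]; exact hS.union hT, Finset.mem_union_left _ hψ,
      Finset.mem_union_right _ hχ⟩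
  induction φ with
  | bot => apply key _ _ hempty <;> first | rintro _ _ ⟨⟩ | rintro _ ⟨⟩
  | atom p => apply key _ _ hempty <;> first | rintro _ _ ⟨⟩ | rintro _ ⟨⟩
  | conj ψ χ h1 h2 =>
    obtain ⟨S, hS, h⟩ := hunion h1 h2
    apply key _ S hS <;> first | (rintro _ _ ⟨⟩ <;> exact h) | rintro _ ⟨⟩
  | disj ψ χ h1 h2 =>
    obtain ⟨S, hS, h⟩ := hunion h1 h2
    apply key _ S hS <;> first | (rintro _ _ ⟨⟩ <;> exact h) | rintro _ ⟨⟩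
  | impl ψ χ h1 h2 =>
    obtain ⟨S, hS, h⟩ := hunion h1 h2
    apply key _ S hS <;> first | (rintro _ _ ⟨⟩ <;> exact h) | rintro _ ⟨⟩
  | know a ψ h =>
    obtain ⟨S, hS, h⟩ := h
    apply key _ S hS <;> first | (rintro _ _ ⟨⟩ <;> exact h) | rintro _ ⟨⟩
  | common ψ h =>
    obtain ⟨S, hS, h⟩ := h
    -- Each `K_a C ψ` leads only back to `C ψ`, so unfolding adds nothing further.
    refine ⟨insert ψ.common (Finset.univ.image (fun a => ψ.common.know a) ∪ S),
      ⟨?_, ?_, ?_, ?_, ?_⟩, Finset.mem_insert_self _ _⟩ <;>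
      simp only [Finset.mem_coe, Finset.mem_insert, Finset.mem_union, Finset.mem_image,
        Finset.mem_univ, true_and, reduceCtorEq, exists_false, false_or,
        Formula.know.injEq, Formula.common.injEq]
    · exact fun _ _ h => ⟨.inr (.inr (hS.conj _ _ h).1), .inr (.inr (hS.conj _ _ h).2)⟩
    · exact fun _ _ h => ⟨.inr (.inr (hS.disj _ _ h).1), .inr (.inr (hS.disj _ _ h).2)⟩
    · exact fun _ _ h => ⟨.inr (.inr (hS.impl _ _ h).1), .inr (.inr (hS.impl _ _ h).2)⟩
    · rintro a χ (⟨_, rfl, rfl⟩ | h)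
      · exact .inl rfl
      · exact .inr (.inr (hS.know _ _ h))
    · rintro χ (rfl | h')
      · exact ⟨.inr (.inr h), fun a => .inl ⟨a, rfl, rfl⟩⟩
      · exact ⟨.inr (.inr (hS.common _ h').1), fun a => .inr ((hS.common _ h').2 a)⟩

theorem Formula.exists_finset_closed_of_finset (Γ : Finset (Formula A P)) :
    ∃ S : Finset (Formula A P), Formula.Closed (S : Set (Formula A P)) ∧ Γ ⊆ S := by
  induction Γ using Finset.induction_on with
  | empty => exact ⟨∅, by constructor <;> simp, subset_rfl⟩
  | insert φ Γ _ ih =>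
    obtain ⟨S, hS, hΓ⟩ := ih
    obtain ⟨T, hT, hφ⟩ := φ.exists_finset_closed
    refine ⟨T ∪ S, by rw [Finset.coe_union]; exact hT.union hS, ?_⟩
    exact Finset.insert_subset (Finset.mem_union_left _ hφ)
      (hΓ.trans Finset.subset_union_right)

/-! ### Saturation -/

/-- Saturation of `Γ ⇒ Δ` under all invertible rules of the calculus `C`. -/
structure Saturated (C : Set (RuleName A)) (Γ Δ : Finset (Formula A P)) : Prop where
  conjL : ∀ φ ψ, Formula.conj φ ψ ∈ Γ → φ ∈ Γ ∧ ψ ∈ Γ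
  conjR : ∀ φ ψ, Formula.conj φ ψ ∈ Δ → φ ∈ Δ ∨ ψ ∈ Δ
  disjL : ∀ φ ψ, Formula.disj φ ψ ∈ Γ → φ ∈ Γ ∨ ψ ∈ Γ
  disjR : ∀ φ ψ, Formula.disj φ ψ ∈ Δ → φ ∈ Δ ∧ ψ ∈ Δ
  implL : ∀ φ ψ, Formula.impl φ ψ ∈ Γ → φ ∈ Δ ∨ ψ ∈ Γ
  commonL : ∀ φ, Formula.common φ ∈ Γ → φ ∈ Γ ∧ ∀ a, Formula.know a (.common φ) ∈ Γ
  commonR : ∀ φ, Formula.common φ ∈ Δ → φ ∈ Δ ∨ ∃ a, Formula.know a (.common φ) ∈ Δ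
  knowT : ∀ a φ, .knowT a ∈ C → Formula.know a φ ∈ Γ → φ ∈ Γ

section

variable {C : Set (RuleName A)} {L : Set (SeqPair A P)} {Γ Δ S : Finset (Formula A P)}
  {F : Finset (AFormula A P)} {φ ψ : Formula A P} {a : A}

/-- In this and the following instances the principal formula also serves as a side formula, so the
premises extend the conclusion (except for `→R`, which discards the right side). This makes
maximality usable. -/
theorem RuleInst.conjL_seq (h : φ.conj ψ ∈ Γ) :
    RuleInst .conjL (seq Γ Δ F) [seq (insert φ (insert ψ Γ)) Δ F] := by
  have := RuleInst.conjL (unfocused Γ) (unfocused Δ ∪ F) φ ψ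
  rwa [insert_unfocused h, ← unfocused_insert, ← unfocused_insert] at this

theorem RuleInst.conjR_seq (h : φ.conj ψ ∈ Δ) :
    RuleInst .conjR (seq Γ Δ F) [seq Γ (insert φ Δ) F, seq Γ (insert ψ Δ) F] := by
  have := RuleInst.conjR (unfocused Γ) (unfocused Δ ∪ F) φ ψ
  rwa [insert_unfocused_union h, ← seq_insert_right, ← seq_insert_right] at this

theorem RuleInst.disjL_seq (h : φ.disj ψ ∈ Γ) :
    RuleInst .disjL (seq Γ Δ F) [seq (insert φ Γ) Δ F, seq (insert ψ Γ) Δ F] := by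
  have := RuleInst.disjL (unfocused Γ) (unfocused Δ ∪ F) φ ψ
  rwa [insert_unfocused h, ← unfocused_insert, ← unfocused_insert] at this

theorem RuleInst.disjR_seq (h : φ.disj ψ ∈ Δ) :
    RuleInst .disjR (seq Γ Δ F) [seq Γ (insert φ (insert ψ Δ)) F] := by
  have := RuleInst.disjR (unfocused Γ) (unfocused Δ ∪ F) φ ψ
  rw [insert_unfocused_union h] at this
  rwa [seq_insert_right, unfocused_insert, Finset.insert_union]

theorem RuleInst.implL_seq (h : φ.impl ψ ∈ Γ) :
    RuleInst .implL (seq Γ Δ F) [seq Γ (insert φ Δ) F, seq (insert ψ Γ) Δ F] := by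
  have := RuleInst.implL (unfocused Γ) (unfocused Δ ∪ F) φ ψ
  rwa [insert_unfocused h, ← seq_insert_right, ← unfocused_insert] at this

theorem RuleInst.implR_seq (h : φ.impl ψ ∈ Δ) :
    RuleInst .implR (seq Γ Δ F) [seq (insert φ Γ) {ψ} ∅] := by
  have := RuleInst.implR (unfocused Γ) (unfocused Δ ∪ F) φ ψ
  rwa [insert_unfocused_union h, ← unfocused_insert, ← seq_singleton_unfocused] at this

theorem RuleInst.commonL_seq (h : φ.common ∈ Γ) :
    RuleInst .commonL (seq Γ Δ F)
      [seq (insert φ (Γ ∪ Finset.univ.image fun a : A => φ.common.know a)) Δ F] := by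
  have := RuleInst.commonL (unfocused Γ) (unfocused Δ ∪ F) φ
  rw [insert_unfocused h] at this
  rwa [seq_insert_left, unfocused, Finset.image_union, Finset.image_image]

theorem RuleInst.commonR_seq (h : φ.common ∈ Δ) :
    RuleInst .commonR (seq Γ Δ F) (seq Γ (insert φ Δ) F ::
      (Finset.univ : Finset A).toList.map fun a => seq Γ (insert (φ.common.know a) Δ) F) := by
  have := RuleInst.commonR (unfocused Γ) (unfocused Δ ∪ F) φ .u
  simp only [insert_unfocused_union h, commonRPremises, ← seq_insert_right] at this
  exact this

theorem RuleInst.knowT_seq (h : φ.know a ∈ Γ) :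
    RuleInst (.knowT a) (seq Γ Δ F) [seq (insert φ Γ) Δ F] := by
  have := RuleInst.knowT a (unfocused Γ) (unfocused Δ ∪ F) φ
  rwa [insert_unfocused h, ← unfocused_insert] at this

/-- A maximal underivable extension within `S` is saturated: were a condition to fail, every premise
of the matching rule would be strictly larger, hence derivable. The focused part `F` is never
touched, so the companions stay available. -/
theorem Derivable.of_saturated (hC : baseRules A ⊆ C)
    (hS : Formula.Closed (S : Set (Formula A P))) (hF : IsFocus F) (hL : L.Nonempty → F.Nonempty)
    (hΓ : Γ ⊆ S) (hΔ : Δ ⊆ S)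
    (h : ∀ Γ' Δ', Γ ⊆ Γ' → Δ ⊆ Δ' → Γ' ⊆ S → Δ' ⊆ S → Saturated C Γ' Δ' →
      Derivable C L (seq Γ' Δ' F)) :
    Derivable C L (seq Γ Δ F) := by
  classical
  by_contra hd
  let T : Finset (Finset (Formula A P) × Finset (Formula A P)) :=
    (S.powerset ×ˢ S.powerset).filter fun p => ¬ Derivable C L (seq p.1 p.2 F)
  have hT : ∀ p, p ∈ T ↔ (p.1 ⊆ S ∧ p.2 ⊆ S) ∧ ¬ Derivable C L (seq p.1 p.2 F) := by
    simp [T]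
  obtain ⟨⟨Γ', Δ'⟩, ⟨hΓΓ, hΔΔ⟩, hmax⟩ := T.exists_le_maximal ((hT (Γ, Δ)).2 ⟨⟨hΓ, hΔ⟩, hd⟩)
  obtain ⟨⟨hΓ', hΔ'⟩, hnd⟩ := (hT _).1 hmax.prop
  simp only at hΓΓ hΔΔ hΓ' hΔ' hnd
  have grow : ∀ Γ'' Δ'', Γ' ⊆ Γ'' → Δ' ⊆ Δ'' → Γ'' ⊆ S → Δ'' ⊆ S →
      ¬ (Γ'' ⊆ Γ' ∧ Δ'' ⊆ Δ') → Derivable C L (seq Γ'' Δ'' F) := by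
    intro Γ'' Δ'' h1 h2 h3 h4 h5
    by_contra h6
    exact h5 (hmax.le_of_ge ((hT (Γ'', Δ'')).2 ⟨⟨h3, h4⟩, h6⟩) ⟨h1, h2⟩)
  have growL : ∀ Θ, Θ ⊆ S → ¬ Θ ⊆ Γ' → Derivable C L (seq (Θ ∪ Γ') Δ' F) := fun Θ h1 h2 =>
    grow _ _ Finset.subset_union_right subset_rfl (Finset.union_subset h1 hΓ') hΔ'
      fun h => h2 (Finset.subset_union_left.trans h.1)
  have growR : ∀ Θ, Θ ⊆ S → ¬ Θ ⊆ Δ' → Derivable C L (seq Γ' (Θ ∪ Δ') F) := fun Θ h1 h2 =>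
    grow _ _ subset_rfl Finset.subset_union_right hΓ' (Finset.union_subset h1 hΔ')
      fun h => h2 (Finset.subset_union_left.trans h.2)
  have growL1 : ∀ φ, φ ∈ S → φ ∉ Γ' → Derivable C L (seq (insert φ Γ') Δ' F) :=
    fun φ h1 h2 => growL {φ} (by simpa using h1) (by simpa using h2)
  have growR1 : ∀ φ, φ ∈ S → φ ∉ Δ' → Derivable C L (seq Γ' (insert φ Δ') F) :=
    fun φ h1 h2 => growR {φ} (by simpa using h1) (by simpa using h2)
  have rule : ∀ {r ps}, r ∈ C → RuleInst r (seq Γ' Δ' F) ps → ps ≠ [] →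
      ¬ ∀ p ∈ ps, Derivable C L p := by
    intro r ps hr hi hps hp
    refine hnd (.step (seq_isSequent hF) hr hi hps subset_rfl (fun hne => ?_) hp)
    rcases hF with rfl | ⟨χ, -, rfl⟩
    · simpa using hL hne
    · exact ⟨_, Finset.mem_union_right _ (Finset.mem_singleton_self _), rfl⟩
  refine hnd (h Γ' Δ' hΓΓ hΔΔ hΓ' hΔ' ⟨?_, ?_, ?_, ?_, ?_, ?_, ?_, ?_⟩)
  · intro φ ψ hm
    have hc := hS.conj _ _ (hΓ' hm)
    by_contra hn
    refine rule (hC (by simp [baseRules])) (.conjL_seq hm) (by simp) ?_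
    simpa using growL {φ, ψ} (by simpa [Finset.insert_subset_iff] using hc)
      (by simpa [Finset.insert_subset_iff] using hn)
  · intro φ ψ hm
    have hc := hS.conj _ _ (hΔ' hm)
    by_contra! hn
    refine rule (hC (by simp [baseRules])) (.conjR_seq hm) (by simp) ?_
    simpa using ⟨growR1 _ hc.1 hn.1, growR1 _ hc.2 hn.2⟩
  · intro φ ψ hm
    have hc := hS.disj _ _ (hΓ' hm)
    by_contra! hn
    refine rule (hC (by simp [baseRules])) (.disjL_seq hm) (by simp) ?_
    simpa using ⟨growL1 _ hc.1 hn.1, growL1 _ hc.2 hn.2⟩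
  · intro φ ψ hm
    have hc := hS.disj _ _ (hΔ' hm)
    by_contra hn
    refine rule (hC (by simp [baseRules])) (.disjR_seq hm) (by simp) ?_
    simpa using growR {φ, ψ} (by simpa [Finset.insert_subset_iff] using hc)
      (by simpa [Finset.insert_subset_iff] using hn)
  · intro φ ψ hm
    have hc := hS.impl _ _ (hΓ' hm)
    by_contra! hn
    refine rule (hC (by simp [baseRules])) (.implL_seq hm) (by simp) ?_
    simpa using ⟨growR1 _ hc.1 hn.1, growL1 _ hc.2 hn.2⟩
  · intro φ hm
    have hc := hS.common _ (hΓ' hm)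
    by_contra hn
    refine rule (hC (by simp [baseRules])) (.commonL_seq hm) (by simp) ?_
    have := growL (insert φ (Finset.univ.image fun a => φ.common.know a))
      (by simpa [Finset.insert_subset_iff, Finset.image_subset_iff] using hc)
      (by simpa [Finset.insert_subset_iff, Finset.image_subset_iff] using hn)
    rw [Finset.insert_union, Finset.union_comm] at this
    simpa using this
  · intro φ hm
    have hc := hS.common _ (hΔ' hm)
    by_contra! hn
    refine rule (hC (by simp [baseRules])) (.commonR_seq hm) (by simp) ?_
    simpa using ⟨growR1 _ hc.1 hn.1, fun a => growR1 _ (hc.2 a) (hn.2 a)⟩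
  · intro a φ ha hm
    by_contra hn
    refine rule ha (.knowT_seq hm) (by simp) ?_
    simpa using growL1 _ (hS.know _ _ (hΓ' hm)) hn

end

/-! ### Canonical worlds -/

/-- Calculi containing the basic rules and rules for knowledge leading from
`Γ ⇒ K_a φ, Ξ` to `N a Γ ⇒ φ`. -/
structure Calculus (C : Set (RuleName A))
    (N : A → Finset (Formula A P) → Finset (Formula A P)) : Prop where
  base : baseRules A ⊆ C
  step : ∀ a Γ Ξ φ e, ∃ r ∈ C, RuleInst r ⟨unfocused Γ, insert (φ.know a, e) Ξ⟩
    [⟨unfocused (N a Γ), {(φ, e)}⟩]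
  mono : ∀ a Γ Γ', Γ ⊆ Γ' → N a Γ ⊆ N a Γ'
  subset : ∀ a Γ (S : Finset (Formula A P)), Formula.Closed (S : Set (Formula A P)) → Γ ⊆ S →
    N a Γ ⊆ S
  -- Saturation of the target is assumed for the sake of S4, where `N a` keeps the boxes and `T_a`
  -- has to remove them.
  mem : ∀ a Γ Γ' Δ' φ, Formula.know a φ ∈ Γ → N a Γ ⊆ Γ' → Saturated C Γ' Δ' → φ ∈ Γ'

/-- Saturated underivable pairs of subsets of `S`. -/
def World (C : Set (RuleName A)) (S : Finset (Formula A P)) : Type (max u v) :=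
  {p : Finset (Formula A P) × Finset (Formula A P) // p.1 ⊆ S ∧ p.2 ⊆ S ∧ Saturated C p.1 p.2 ∧
    ∃ F, IsFocus F ∧ ¬ Derivable C ∅ (seq p.1 p.2 F)}

namespace World

variable {C : Set (RuleName A)} {N : A → Finset (Formula A P) → Finset (Formula A P)}
  {S Γ Δ : Finset (Formula A P)} {F : Finset (AFormula A P)}

/-- The formulae that a world makes true. -/
def pos (w : World C S) : Finset (Formula A P) := w.1.1

/-- The formulae that a world makes false. -/
def neg (w : World C S) : Finset (Formula A P) := w.1.2

theorem pos_subset (w : World C S) : w.pos ⊆ S := w.2.1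

theorem neg_subset (w : World C S) : w.neg ⊆ S := w.2.2.1

theorem saturated (w : World C S) : Saturated C w.pos w.neg := w.2.2.2.1

theorem exists_not_derivable (w : World C S) :
    ∃ F, IsFocus F ∧ ¬ Derivable C ∅ (seq w.pos w.neg F) := w.2.2.2.2

/-- Makes `World C S × ℕ` countable, hence small in every universe. -/
instance : Finite (World C S) :=
  Set.Finite.to_subtype ((S.powerset ×ˢ S.powerset).finite_toSet.subset fun p hp => by
    simp only [Finset.coe_product, Finset.coe_powerset, Set.mem_prod, Set.mem_preimage,
      Set.mem_powerset_iff, Finset.coe_subset]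
    exact ⟨hp.1, hp.2.1⟩)

theorem exists_of_not_derivable (hC : baseRules A ⊆ C)
    (hS : Formula.Closed (S : Set (Formula A P))) (hF : IsFocus F) (hΓ : Γ ⊆ S) (hΔ : Δ ⊆ S)
    (h : ¬ Derivable C ∅ (seq Γ Δ F)) : ∃ w : World C S, Γ ⊆ w.pos ∧ Δ ⊆ w.neg := by
  by_contra! hw
  refine h (.of_saturated hC hS hF (by simp) hΓ hΔ fun Γ' Δ' h1 h2 h3 h4 h5 => ?_)
  by_contra hd
  exact hw ⟨(Γ', Δ'), h3, h4, h5, F, hF, hd⟩ h1 h2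

theorem not_derivable_premise (w : World C S) {r : RuleName A} {p : SeqPair A P} (hr : r ∈ C)
    (h : ∀ F, RuleInst r (seq w.pos w.neg F) [p]) : ¬ Derivable C ∅ p := by
  intro hp
  obtain ⟨F, hF, hd⟩ := w.exists_not_derivable
  exact hd (.step (seq_isSequent hF) hr (h F) (by simp) subset_rfl (by simp) (by simpa using hp))

theorem not_isAxiom (w : World C S) : ∃ F, ¬ IsAxiom (seq w.pos w.neg F) := by
  obtain ⟨F, hF, hd⟩ := w.exists_not_derivable
  exact ⟨F, fun h => hd (.ax (seq_isSequent hF) h)⟩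

theorem bot_notMem_pos (w : World C S) : Formula.bot ∉ w.pos := by
  intro h
  obtain ⟨F, hF⟩ := w.not_isAxiom
  refine hF (.inr ?_)
  have := RuleInst.bot (unfocused w.pos) (unfocused w.neg ∪ F)
  rwa [insert_unfocused h] at this

theorem notMem_neg_of_mem_pos (w : World C S) {φ : Formula A P} (h : φ ∈ w.pos) :
    φ ∉ w.neg := by
  intro h'
  obtain ⟨F, hF⟩ := w.not_isAxiom
  refine hF (.inl ?_)
  have := RuleInst.id (unfocused w.pos) (unfocused w.neg ∪ F) φ .u
  rwa [insert_unfocused h, insert_unfocused_union h'] at this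

theorem exists_of_impl_mem_neg (hC : baseRules A ⊆ C)
    (hS : Formula.Closed (S : Set (Formula A P))) (w : World C S) {φ ψ : Formula A P}
    (h : φ.impl ψ ∈ w.neg) : ∃ v : World C S, w.pos ⊆ v.pos ∧ φ ∈ v.pos ∧ ψ ∈ v.neg := by
  have hc := hS.impl _ _ (w.neg_subset h)
  obtain ⟨v, hp, hn⟩ := exists_of_not_derivable hC hS isFocus_empty
    (Finset.insert_subset hc.1 w.pos_subset) (Finset.singleton_subset_iff.2 hc.2)
    (w.not_derivable_premise (hC (by simp [baseRules])) fun F => RuleInst.implR_seq h)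
  rw [Finset.insert_subset_iff] at hp
  exact ⟨v, hp.2, hp.1, Finset.singleton_subset_iff.1 hn⟩

theorem not_derivable_of_know_mem_neg (hC : Calculus C N) (w : World C S) {a : A}
    {φ : Formula A P} (h : φ.know a ∈ w.neg) : ¬ Derivable C ∅ (seq (N a w.pos) {φ} ∅) := by
  intro hd
  obtain ⟨F, hF, hnd⟩ := w.exists_not_derivable
  obtain ⟨r, hr, hi⟩ := hC.step a w.pos (unfocused w.neg ∪ F) φ .u
  rw [insert_unfocused_union h, ← seq_singleton_unfocused] at hi
  exact hnd (.step (seq_isSequent hF) hr hi (by simp) subset_rfl (by simp) (by simpa using hd))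

theorem exists_of_know_mem_neg (hC : Calculus C N) (hS : Formula.Closed (S : Set (Formula A P)))
    (w : World C S) {a : A} {φ : Formula A P} (h : φ.know a ∈ w.neg) :
    ∃ v : World C S, N a w.pos ⊆ v.pos ∧ φ ∈ v.neg := by
  obtain ⟨v, hp, hn⟩ := exists_of_not_derivable hC.base hS isFocus_empty
    (hC.subset a _ S hS w.pos_subset)
    (Finset.singleton_subset_iff.2 (hS.know _ _ (w.neg_subset h)))
    (w.not_derivable_of_know_mem_neg hC h)
  exact ⟨v, hp, Finset.singleton_subset_iff.1 hn⟩

/-- Accessibility between worlds by some agent. -/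
def Step (N : A → Finset (Formula A P) → Finset (Formula A P)) (w v : World C S) : Prop :=
  ∃ a, N a w.pos ⊆ v.pos

/-- Proof search that cannot fail: induction on the number of pairs over `S` whose sequent with `C
φ` in focus is not yet a companion. The hypothesis on `Γ` says that every world met during the
search is reachable from `w`. -/
theorem derivable_common (hC : Calculus C N) (hS : Formula.Closed (S : Set (Formula A P)))
    {φ : Formula A P} (hφ : φ ∈ S) (w : World C S)
    (hw : ∀ v, Relation.TransGen (Step N) w v → φ ∉ v.neg) (L : Set (SeqPair A P)) (hΓ : Γ ⊆ S)
    (hacc : ∀ v : World C S, Γ ⊆ v.pos → Relation.TransGen (Step N) w v) :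
    Derivable C L (seq Γ ∅ {(φ.common, Ann.f)}) := by
  classical
  induction hn : ((S.powerset ×ˢ S.powerset).filter fun p =>
      seq p.1 p.2 {(φ.common, Ann.f)} ∉ L).card using Nat.strong_induction_on
    generalizing L Γ with
  | h n ih =>
  subst hn
  refine .of_saturated hC.base hS (isFocus_common φ) (fun _ => Finset.singleton_nonempty _) hΓ
    (Finset.empty_subset _) fun Γ' Δ' hΓΓ _ hΓ' hΔ' hsat => ?_
  have hs : (seq Γ' Δ' {(φ.common, Ann.f)}).IsSequent := seq_isSequent (isFocus_common φ)
  by_cases hd : Derivable C ∅ (seq Γ' Δ' {(φ.common, Ann.f)})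
  -- Otherwise the saturated pair is underivable, and so is itself a world.
  · exact hd.mono (Set.empty_subset _)
  have hins : ∀ x : AFormula A P, unfocused Δ' ∪ {x} = insert x (unfocused Δ') := fun x => by
    rw [Finset.union_comm, Finset.insert_eq]
  have hfoc : FocusedCommonR (seq Γ' Δ' {(φ.common, Ann.f)})
      (commonRPremises (unfocused Γ') (unfocused Δ') φ .f) :=
    ⟨_, _, _, by rw [seq, hins], rfl⟩
  by_cases hl : seq Γ' Δ' {(φ.common, Ann.f)} ∈ L
  · exact .loop hs hfoc.hasFocus hl
  let v : World C S := ⟨(Γ', Δ'), hΓ', hΔ', hsat, _, isFocus_common φ, hd⟩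
  refine .unfold hs (hC.base (by simp [baseRules])) hfoc fun p hp => ?_
  rcases List.mem_cons.1 hp with rfl | hp
  -- This premise has lost the focus, so it must be derived without companions.
  · refine Derivable.mono (L := ∅) ?_ (Set.empty_subset _)
    have : (⟨unfocused Γ', insert (φ, Ann.u) (unfocused Δ')⟩ : SeqPair A P) =
        seq Γ' (insert φ Δ') ∅ := by rw [seq, unfocused_insert, Finset.union_empty]
    rw [this]
    by_contra hnd
    obtain ⟨t, ht, htn⟩ := exists_of_not_derivable hC.base hS isFocus_empty hΓ'
      (Finset.insert_subset hφ hΔ') hnd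
    exact hw t (hacc t (hΓΓ.trans ht)) (htn (Finset.mem_insert_self _ _))
  · obtain ⟨a, -, rfl⟩ := List.mem_map.1 hp
    obtain ⟨r, hr, hi⟩ := hC.step a Γ' (unfocused Δ') φ.common .f
    rw [← seq_empty] at hi
    refine .step (by rw [← hins]; exact seq_isSequent (isFocus_know_common a φ)) hr hi (by simp)
      subset_rfl (fun _ => ⟨_, Finset.mem_insert_self _ _, rfl⟩) ?_
    simp only [List.mem_singleton, forall_eq]
    -- The unfolded sequent is now a companion, so the measure drops; worlds above `N a Γ'` are
    -- successors of `v`.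
    refine ih _ (Finset.card_lt_card ?_) _ (hC.subset a _ S hS hΓ')
      (fun t ht => (hacc v hΓΓ).tail ⟨a, ht⟩) rfl
    refine Finset.ssubset_iff_of_subset ?_ |>.2 ⟨(Γ', Δ'), ?_, ?_⟩
    · intro q
      simp only [Finset.mem_filter, Set.mem_insert_iff, not_or]
      exact fun h => ⟨h.1, h.2.2⟩
    · simp [hΓ', hΔ', hl]
    · simp

/-- Saturation puts `φ` or some `K_a C φ` on the right. In the latter case, if no reachable world
refuted `φ`, the modal premise would be derivable by bringing `C φ` into focus and applying
`derivable_common`. -/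
theorem exists_of_common_mem_neg (hC : Calculus C N)
    (hS : Formula.Closed (S : Set (Formula A P))) (w : World C S) {φ : Formula A P}
    (h : φ.common ∈ w.neg) :
    ∃ v : World C S, Relation.ReflTransGen (Step N) w v ∧ φ ∈ v.neg := by
  by_contra! hw
  obtain hφ | ⟨a, ha⟩ := w.saturated.commonR φ h
  · exact hw w .refl hφ
  refine w.not_derivable_of_know_mem_neg hC ha ?_
  have hd := derivable_common hC hS (hS.common _ (w.neg_subset h)).1 w
    (fun v hv => hw v hv.to_reflTransGen) ∅ (hC.subset a _ S hS w.pos_subset)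
    fun v hv => .single ⟨a, hv⟩
  have hi := RuleInst.focus (unfocused (N a w.pos)) ∅ φ.common
  refine .step (seq_isSequent isFocus_empty) (hC.base (by simp [baseRules] : RuleName.focus ∈ _))
    (by rw [seq_singleton_unfocused]; exact hi) (by simp) subset_rfl (by simp) ?_
  simpa [seq_empty] using hd

end World

/-! ### The canonical model -/

section

variable {C : Set (RuleName A)} {N : A → Finset (Formula A P) → Finset (Formula A P)}
  {S : Finset (Formula A P)} {X : Type w} (e : X ≃ World C S × ℕ)

/-- Inclusion of true formulae, made antisymmetric by a second coordinate that increases. -/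
@[reducible]
def canonicalOrder : PartialOrder X where
  le x y := x = y ∨ (e x).1.pos ⊆ (e y).1.pos ∧ (e x).2 < (e y).2
  le_refl _ := .inl rfl
  le_trans x y z := by
    rintro (rfl | h) (rfl | h')
    · exact .inl rfl
    · exact .inr h'
    · exact .inr h
    · exact .inr ⟨h.1.trans h'.1, h.2.trans h'.2⟩
  le_antisymm x y := by
    rintro (rfl | h) (h' | h')
    · rfl
    · rfl
    · exact h'.symm
    · exact (h.2.asymm h'.2).elim

theorem pos_subset_of_canonicalOrder_le {x y : X} (h : (canonicalOrder e).le x y) :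
    (e x).1.pos ⊆ (e y).1.pos := by
  rcases h with rfl | h
  exacts [subset_rfl, h.1]

/-- The canonical model. -/
def canonicalModel [Nonempty X] (N : A → Finset (Formula A P) → Finset (Formula A P)) :
    BirelationalModel.{u, v, w} A P where
  frame :=
    { World := X
      order := canonicalOrder e
      R a x y := N a (e x).1.pos ⊆ (e y).1.pos }
  V x := {p | .atom p ∈ (e x).1.pos}
  V_mono _ _ h _ hp := pos_subset_of_canonicalOrder_le e h hp

variable [Nonempty X]

/-- Accessibility ignores the counter, so paths between worlds lift with arbitrary counters after
the start. -/
theorem canonicalModel_reachable (x : X) {v : World C S}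
    (h : Relation.ReflTransGen (World.Step N) (e x).1 v) :
    ∃ n, Relation.ReflTransGen (fun s t => ∃ a, (canonicalModel e N).frame.R a s t) x
      (e.symm (v, n)) := by
  induction h with
  | refl => exact ⟨(e x).2, by simpa using .refl⟩
  | tail _ h ih =>
    obtain ⟨n, hn⟩ := ih
    obtain ⟨a, ha⟩ := h
    exact ⟨0, hn.tail ⟨a, by simpa [canonicalModel] using ha⟩⟩

theorem canonicalModel_common_mem (hC : Calculus C N) {x y : X} {φ : Formula A P}
    (h : Relation.ReflTransGen (fun s t => ∃ a, (canonicalModel e N).frame.R a s t) x y)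
    (hφ : φ.common ∈ (e x).1.pos) : φ.common ∈ (e y).1.pos := by
  induction h with
  | refl => exact hφ
  | @tail s t _ h ih =>
    obtain ⟨a, ha⟩ := h
    exact hC.mem a _ _ _ _ (((e s).1.saturated.commonL _ ih).2 a) ha (e t).1.saturated

theorem canonicalModel_truth (hC : Calculus C N) (hS : Formula.Closed (S : Set (Formula A P)))
    (φ : Formula A P) (x : X) :
    (φ ∈ (e x).1.pos → Sat (canonicalModel e N) x φ) ∧
      (φ ∈ (e x).1.neg → ¬ Sat (canonicalModel e N) x φ) := by
  induction φ generalizing x with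
  | bot => exact ⟨fun h => ((e x).1.bot_notMem_pos h).elim, fun _ h => h⟩
  | atom p => exact ⟨fun h => h, fun h h' => (e x).1.notMem_neg_of_mem_pos h' h⟩
  | conj φ ψ hφ hψ =>
    refine ⟨fun h => ?_, fun h h' => ?_⟩
    · have := (e x).1.saturated.conjL _ _ h
      exact ⟨(hφ x).1 this.1, (hψ x).1 this.2⟩
    · rcases (e x).1.saturated.conjR _ _ h with h | h
      exacts [(hφ x).2 h h'.1, (hψ x).2 h h'.2]
  | disj φ ψ hφ hψ =>
    refine ⟨fun h => ?_, fun h h' => ?_⟩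
    · exact ((e x).1.saturated.disjL _ _ h).imp (hφ x).1 (hψ x).1
    · have := (e x).1.saturated.disjR _ _ h
      exact h'.elim ((hφ x).2 this.1) ((hψ x).2 this.2)
  | impl φ ψ hφ hψ =>
    refine ⟨fun h y hxy hy => ?_, fun h h' => ?_⟩
    · have h := pos_subset_of_canonicalOrder_le e hxy h
      rcases (e y).1.saturated.implL _ _ h with h | h
      exacts [((hφ y).2 h hy).elim, (hψ y).1 h]
    · obtain ⟨v, hv, h1, h2⟩ := (e x).1.exists_of_impl_mem_neg hC.base hS h
      have hv' : e (e.symm (v, (e x).2 + 1)) = (v, (e x).2 + 1) := e.apply_symm_apply _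
      -- The counter must increase strictly for the new point to lie above `x`.
      refine (hψ (e.symm (v, (e x).2 + 1))).2 (by rwa [hv']) (h' _ (.inr ?_)
        ((hφ _).1 (by rwa [hv'])))
      rw [hv']
      exact ⟨hv, Nat.lt_succ_self _⟩
  | know a φ hφ =>
    refine ⟨fun h y hxy => (hφ y).1 (hC.mem a _ _ _ _ h hxy (e y).1.saturated), fun h h' => ?_⟩
    obtain ⟨v, hv, h1⟩ := (e x).1.exists_of_know_mem_neg hC hS h
    have hv' : e (e.symm (v, 0)) = (v, 0) := e.apply_symm_apply _
    refine (hφ (e.symm (v, 0))).2 (by rwa [hv']) (h' _ ?_)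
    change N a _ ⊆ _
    rwa [hv']
  | common φ hφ =>
    refine ⟨fun h y hxy => (hφ y).1
      ((e y).1.saturated.commonL _ (canonicalModel_common_mem e hC hxy h)).1, fun h h' => ?_⟩
    obtain ⟨v, hv, h1⟩ := (e x).1.exists_of_common_mem_neg hC hS h
    obtain ⟨n, hn⟩ := canonicalModel_reachable e x hv
    exact (hφ _).2 (by rwa [e.apply_symm_apply]) (h' _ hn)

theorem canonicalModel_mem_epistemicFrames (hC : Calculus C N) :
    (canonicalModel e N).frame ∈ epistemicFrames A :=
  fun a _ _ _ h h' => (hC.mono a _ _ (pos_subset_of_canonicalOrder_le e h)).trans h'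

end

/-! ### Completeness -/

/-- At most one formula is in focus, so a single use of the rule `u` removes all focus annotations.
-/
theorem Derivable.of_plain {C : Set (RuleName A)} (hC : baseRules A ⊆ C) (σ : Sequent A P)
    (h : Derivable C ∅ (seq (plain σ.left) (plain σ.right) ∅)) :
    Derivable C ∅ σ.toSeqPair := by
  rw [seq, Finset.union_empty, ← σ.left_eq] at h
  by_cases hf : ∃ x ∈ σ.right, x.2 = Ann.f
  · obtain ⟨⟨χ, e⟩, hx, hxf⟩ := hf
    obtain rfl : e = Ann.f := hxf
    have h1 : insert (χ, Ann.f) (σ.right.erase (χ, Ann.f)) = σ.right := Finset.insert_erase hx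
    have h2 : insert (χ, Ann.u) (σ.right.erase (χ, Ann.f)) = unfocused (plain σ.right) := by
      ext ⟨ψ, e⟩
      simp only [mem_unfocused, plain, Finset.mem_image, Finset.mem_insert, Finset.mem_erase]
      constructor
      · rintro (h | ⟨hne, h⟩)
        · cases h
          exact ⟨⟨_, hx, rfl⟩, rfl⟩
        · refine ⟨⟨_, h, rfl⟩, ?_⟩
          cases e with
          | u => rfl
          | f => exact (hne (σ.right_focus_unique _ h _ hx rfl rfl)).elim
      · rintro ⟨⟨⟨ψ', e'⟩, h, rfl⟩, he⟩
        obtain rfl : e = Ann.u := he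
        cases e' with
        | u => exact .inr ⟨by simp, h⟩
        | f =>
          cases σ.right_focus_unique _ h _ hx rfl rfl
          exact .inl rfl
    have hi := RuleInst.unfocus σ.left (σ.right.erase (χ, Ann.f)) χ
    rw [h1, h2] at hi
    exact .step ⟨σ, rfl⟩ (hC (by simp [baseRules])) hi (by simp) subset_rfl (by simp)
      (by simpa using h)
  · push Not at hf
    have hr : unfocused (plain σ.right) = σ.right := by
      ext x
      simp only [mem_unfocused, plain, Finset.mem_image]
      have hu : ∀ y ∈ σ.right, y.2 = Ann.u := fun y hy => by
        cases hy2 : y.2 with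
        | u => rfl
        | f => exact (hf y hy hy2).elim
      constructor
      · rintro ⟨⟨y, hy, hyx⟩, hx⟩
        rwa [← Prod.ext hyx ((hu y hy).trans hx.symm)]
      · exact fun h => ⟨⟨x, h, rfl⟩, hu x h⟩
    rwa [hr] at h

theorem Calculus.hasCyclicProof {C : Set (RuleName A)}
    {N : A → Finset (Formula A P) → Finset (Formula A P)} (hC : Calculus C N)
    {𝓕 : Set (BirelationalFrame.{u, w} A)}
    (h𝓕 : ∀ (S : Finset (Formula A P)) (X : Type w) [Nonempty X] (e : X ≃ World C S × ℕ),
      (canonicalModel e N).frame ∈ 𝓕)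
    {σ : Sequent A P} (hσ : σ.Valid 𝓕) : HasCyclicProof C σ := by
  refine Derivable.hasCyclicProof (.of_plain hC.base σ ?_)
  by_contra hd
  obtain ⟨S, hS, hsub⟩ :=
    Formula.exists_finset_closed_of_finset (plain σ.left ∪ plain σ.right)
  obtain ⟨w, hp, hn⟩ := World.exists_of_not_derivable hC.base hS isFocus_empty
    (Finset.subset_union_left.trans hsub) (Finset.subset_union_right.trans hsub) hd
  -- The frames quantified over live in an arbitrary universe, so the countable canonical model is
  -- transported there.
  let e : Shrink.{w} (World C S × ℕ) ≃ World C S × ℕ := (equivShrink _).symm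
  have hx : e (e.symm (w, 0)) = (w, 0) := e.apply_symm_apply _
  have : Nonempty (Shrink.{w} (World C S × ℕ)) := ⟨e.symm (w, 0)⟩
  have h := hσ (canonicalModel e N) (h𝓕 S _ e) (e.symm (w, 0)) (e.symm (w, 0)) le_rfl
    (sat_bigConj.2 fun φ hφ => (canonicalModel_truth e hC hS φ _).1 (by
      rw [hx]; exact hp (Finset.mem_toList.1 hφ)))
  obtain ⟨φ, hφ, h⟩ := sat_bigDisj.1 h
  exact (canonicalModel_truth e hC hS φ _).2 (by
    rw [hx]; exact hn (Finset.mem_toList.1 hφ)) h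

theorem calculus_unknow {C : Set (RuleName A)} (hb : baseRules A ⊆ C)
    (hk : ∀ a, RuleName.know a ∈ C) : Calculus (P := P) C unknow where
  base := hb
  step a Γ Ξ φ e := ⟨_, hk a, by
    have := RuleInst.know a (unfocused (unknow a Γ)) (unfocused Γ) Ξ φ e
    rwa [unfocused_union_knowSet] at this⟩
  mono _ _ _ h _ hφ := mem_unknow.2 (h (mem_unknow.1 hφ))
  subset _ _ _ hS h _ hφ := hS.know _ _ (h (mem_unknow.1 hφ))
  mem _ _ _ _ _ h hN _ := hN (mem_unknow.2 h)

theorem calculus_know_unknow {C : Set (RuleName A)} (hb : baseRules A ⊆ C)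
    (ht : ∀ a, RuleName.knowT a ∈ C) (hk : ∀ a, RuleName.knowS4 a ∈ C) :
    Calculus (P := P) C fun a Γ => (unknow a Γ).image (Formula.know a) where
  base := hb
  step a Γ Ξ φ e := ⟨_, hk a, by
    have := RuleInst.knowS4 a (unfocused (unknow a Γ)) (unfocused Γ) Ξ φ e
    rwa [unfocused_union_knowSet, knowSet_unfocused] at this⟩
  mono _ _ _ h := Finset.image_subset_image fun _ hφ => mem_unknow.2 (h (mem_unknow.1 hφ))
  subset a Γ _ _ h := (image_know_unknow_subset a Γ).trans h
  mem a _ _ _ _ h hN hs :=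
    hs.knowT a _ (ht a) (hN (Finset.mem_image_of_mem _ (mem_unknow.2 h)))

theorem calculus_cICK : Calculus (P := P) (cICK A) unknow :=
  calculus_unknow Set.subset_union_left fun a => .inr ⟨a, rfl⟩

theorem calculus_cICKT : Calculus (P := P) (cICKT A) unknow :=
  calculus_unknow (Set.subset_union_left.trans Set.subset_union_left)
    fun a => .inl (.inr ⟨a, rfl⟩)

theorem calculus_cICKS4 :
    Calculus (P := P) (cICKS4 A) fun a Γ => (unknow a Γ).image (Formula.know a) := by
  refine calculus_know_unknow (fun r hr => .inl ⟨.inl (.inl hr), ?_⟩)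
    (fun a => .inl ⟨.inr ⟨a, rfl⟩, by simp⟩) fun a => .inr ⟨a, rfl⟩
  rintro ⟨a, rfl⟩
  simp [baseRules] at hr

end ICK

theorem mainTheorem8 {A : Type u} [Fintype A] [Nonempty A]
    {P : Type v} [Countable P] [Infinite P] :
    (∀ σ : ICK.Sequent A P,
      (σ.Valid (ICK.epistemicFrames.{u, w} A) → ICK.HasCyclicProof (ICK.cICK A) σ) ∧
      (σ.Valid (ICK.reflexiveFrames.{u, w} A) → ICK.HasCyclicProof (ICK.cICKT A) σ) ∧
      (σ.Valid (ICK.s4Frames.{u, w} A) → ICK.HasCyclicProof (ICK.cICKS4 A) σ)) ∧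
    (∀ r ∈ ICK.cICK A ∪ ICK.cICKT A ∪ ICK.cICKS4 A, ICK.RuleName.Analytic P r) := by
  refine ⟨fun σ => ⟨?_, ?_, ?_⟩, fun r _ => r.analytic⟩
  · exact ICK.calculus_cICK.hasCyclicProof fun S X _ e =>
      ICK.canonicalModel_mem_epistemicFrames e ICK.calculus_cICK
  · exact ICK.calculus_cICKT.hasCyclicProof (𝓕 := ICK.reflexiveFrames A) fun S X _ e =>
      -- Reflexivity is saturation under `T_a`.
      ⟨ICK.canonicalModel_mem_epistemicFrames e ICK.calculus_cICKT, fun a x φ h =>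
        (e x).1.saturated.knowT a φ (.inr ⟨a, rfl⟩) (ICK.mem_unknow.1 h)⟩
  · refine ICK.calculus_cICKS4.hasCyclicProof (𝓕 := ICK.s4Frames A) fun S X _ e =>
      ⟨ICK.canonicalModel_mem_epistemicFrames e ICK.calculus_cICKS4,
        fun a x => ICK.image_know_unknow_subset a _, fun a x y z hxy hyz => ?_⟩
    -- Transitivity holds because `N a` keeps the formulae boxed, so they persist along each step.
    refine subset_trans (fun ψ hψ => ?_) hyz
    obtain ⟨φ, hφ, rfl⟩ := Finset.mem_image.1 hψ
    exact Finset.mem_image_of_mem _ (ICK.mem_unknow.2 (hxy hψ))
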